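/- Let $n\ge 1$, let $\sigma$ be the rotation invariant probability measure on the unit sphere $S^{n-1}\subset\mathbb R^n$, and write $\|\cdot\|_2$ for the norm of the real space $L_2(S^{n-1},\sigma)$. For an orthonormal basis $v_1,\dots,v_n$ of $\mathbb R^n$ and a function $f:S^{n-1}\to\mathbb R$, the orthogonal symmetrization of $f$ with respect to $v_1,\dots,v_n$ is the function $$f'_{v_1,\dots,v_n}(x)=\frac1{2^n}\sum_{\varepsilon\in\{\pm1\}^n} f\Big(\sum_{i=1}^n\varepsilon_i\langle x,v_i\rangle v_i\Big),\qquad x\in S^{n-1}.$$ Let $f\in L_2(S^{n-1})$ satisfy $\int_{S^{n-1}}f\,d\sigma=0$, and suppose that $f$ is not zero $\sigma$-almost everywhere. Then $f'_{v_1,\dots,v_n}\in L_2(S^{n-1})$ for every orthonormal basis $v_1,\dots,v_n$. If $v_1,\dots,v_n$ are the columns of a random matrix $U\in O(n)$ distributed according to the Haar probability measure on $O(n)$, then $\|f'_{v_1,\dots,v_n}\|_2$ is integrable as a function of $U$, and $$\mathbb E\,\|f'_{v_1,\dots,v_n}\|_2<\frac{\sqrt2}{\sqrt n}\,\|f\|_2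 .$$ -/

import Mathlib

open MeasureTheory

namespace OrthogonalSymmetrization

/-- The Euclidean unit sphere `S^{n-1}` in `ℝⁿ`. -/
abbrev Sph (n : ℕ) : Type := Metric.sphere (0 : EuclideanSpace ℝ (Fin n)) 1

/-- The rotation invariant probability measure `σ` on `S^{n-1}`: the surface measure on the sphere,
normalised to have total mass `1` (for `n ≥ 1`). -/
noncomputable def sphereProb (n : ℕ) : Measure (Sph n) :=
  ((volume : Measure (EuclideanSpace ℝ (Fin n))).toSphere Set.univ)⁻¹ •
    (volume : Measure (EuclideanSpace ℝ (Fin n))).toSphere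

/-- The norm `‖f‖₂` of `L₂(S^{n-1})`, for the measure `σ`. -/
noncomputable def l2Norm {n : ℕ} (f : Sph n → ℝ) : ℝ :=
  (eLpNorm f 2 (sphereProb n)).toReal

/-- For an orthonormal basis `b = {e₁, …, eₙ}` and signs `ε ∈ {±1}ⁿ`, the map
`x ↦ ∑ i, εᵢ ⟨x, eᵢ⟩ eᵢ`. -/
noncomputable def signFlip {n : ℕ} (b : OrthonormalBasis (Fin n) ℝ (EuclideanSpace ℝ (Fin n)))
    (ε : Fin n → ℤˣ) (x : EuclideanSpace ℝ (Fin n)) : EuclideanSpace ℝ (Fin n) :=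
  ∑ i, (((ε i : ℤ) : ℝ) * inner ℝ x (b i)) • b i

theorem norm_signFlip {n : ℕ} (b : OrthonormalBasis (Fin n) ℝ (EuclideanSpace ℝ (Fin n)))
    (ε : Fin n → ℤˣ) (x : EuclideanSpace ℝ (Fin n)) : ‖signFlip b ε x‖ = ‖x‖ := by
  have h : ‖signFlip b ε x‖ ^ 2 = ‖x‖ ^ 2 := by
    rw [← b.sum_sq_norm_inner_left x, ← b.sum_sq_norm_inner_left (signFlip b ε x)]
    refine Finset.sum_congr rfl fun i _ => ?_
    have h1 : inner ℝ (signFlip b ε x) (b i) = ((ε i : ℤ) : ℝ) * inner ℝ x (b i) := by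
      simp [signFlip, sum_inner, inner_smul_left, b.inner_eq_ite]
    rw [h1]
    rcases Int.units_eq_one_or (ε i) with h2 | h2 <;> simp [h2]
  exact (sq_eq_sq₀ (norm_nonneg _) (norm_nonneg _)).1 h

/-- The map `signFlip b ε`, restricted to the sphere. -/
noncomputable def sphereFlip {n : ℕ} (b : OrthonormalBasis (Fin n) ℝ (EuclideanSpace ℝ (Fin n)))
    (ε : Fin n → ℤˣ) (x : Sph n) : Sph n :=
  ⟨signFlip b ε x.1, by
    rw [mem_sphere_zero_iff_norm, norm_signFlip]; exact mem_sphere_zero_iff_norm.1 x.2⟩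

/-- The orthogonal symmetrization of `f` with respect to the orthonormal basis `b = {e₁, …, eₙ}`:
`f'(x) = 𝔼_ε f (∑ i, εᵢ ⟨x, eᵢ⟩ eᵢ)`, with `ε` uniform on the discrete cube `{±1}ⁿ`. -/
noncomputable def orthoSymm {n : ℕ} (b : OrthonormalBasis (Fin n) ℝ (EuclideanSpace ℝ (Fin n)))
    (f : Sph n → ℝ) (x : Sph n) : ℝ :=
  (∑ ε : Fin n → ℤˣ, f (sphereFlip b ε x)) / 2 ^ n

/-- The orthogonal group `O(n)`. -/
abbrev On (n : ℕ) : Type := Matrix.orthogonalGroup (Fin n) ℝ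

/-- The `j`-th column of an orthogonal matrix, as a vector of `ℝⁿ`. -/
noncomputable def column {n : ℕ} (U : On n) (j : Fin n) : EuclideanSpace ℝ (Fin n) :=
  WithLp.toLp 2 fun i => U.1 i j

theorem orthonormal_column {n : ℕ} (U : On n) : Orthonormal ℝ (column U) := by
  rw [orthonormal_iff_ite]
  intro i j
  have h := congrFun (congrFun ((Matrix.mem_orthogonalGroup_iff' (Fin n) ℝ).1 U.2) i) j
  rw [Matrix.mul_apply, Matrix.one_apply] at h
  rw [← h]
  simp [column, PiLp.inner_apply, mul_comm]

/-- The orthonormal basis `{v₁, …, vₙ}` of `ℝⁿ` formed by the columns of `U ∈ O(n)`. -/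
noncomputable def columnBasis {n : ℕ} (U : On n) :
    OrthonormalBasis (Fin n) ℝ (EuclideanSpace ℝ (Fin n)) :=
  OrthonormalBasis.mk (orthonormal_column U) (by
    rw [(orthonormal_column U).linearIndependent.span_eq_top_of_card_eq_finrank' (by simp)])

instance instCompactSpaceOn (n : ℕ) : CompactSpace (On n) := by
  refine isCompact_iff_compactSpace.1 ?_
  have hK : IsCompact (Set.univ.pi fun _ : Fin n => Set.univ.pi fun _ : Fin n =>
      Set.Icc (-1 : ℝ) 1) :=
    isCompact_univ_pi fun _ => isCompact_univ_pi fun _ => isCompact_Icc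
  refine hK.of_isClosed_subset (isClosed_unitary (R := Matrix (Fin n) (Fin n) ℝ)) ?_
  intro U hU i _ j _
  have h := entry_norm_bound_of_unitary (𝕜 := ℝ) hU i j
  exact abs_le.1 h

instance instMeasurableSpaceOn (n : ℕ) : MeasurableSpace (On n) := borel _

instance instBorelSpaceOn (n : ℕ) : BorelSpace (On n) := ⟨rfl⟩

/-- The Haar probability measure `μ` on the (compact) group `O(n)`. -/
noncomputable def haarOn (n : ℕ) : Measure (On n) := Measure.haarMeasure ⊤

end OrthogonalSymmetrization

/-!
Write `P_U f` for the symmetrization of `f` with respect to the columns of `U`. It is the average of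
`f` over a group of isometries of the sphere, hence an orthogonal projection of `L₂`, and
`‖P_U f‖² = ⟨P_U f, f⟩`. By the Cauchy-Schwarz inequality in `U` it suffices to bound the averaged
form `⟨T f, f⟩`, where `T = 𝔼_U P_U`. The claim is that `⟨T f, f⟩ ≤ 2 / (n + 2) * ‖f‖²` for `f` of
mean zero; since `2 / (n + 2) < 2 / n` and `‖f‖ > 0`, the inequality for the norms is strict.

The form is first bounded on polynomials, without spherical harmonics. For unit vectors `x`, `b`, the
value of `T ⟨·, b⟩ ^ k` at `x` is the average over signs and over `U` of
`(∑ i, εᵢ ⟨x, vᵢ⟩⟨b, vᵢ⟩) ^ k`. Rotate `x` and `b` into a plane symmetrically about the first axis, so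
that `b = α e₁ + β e₂` and `x = α e₁ - β e₂`. With `c = ⟨x, b⟩ = α² - β²` and `wᵢ`, `zᵢ` the entries of
two rows of `U`, the sum becomes `c * M + N`, where `M = ∑ i, εᵢ (wᵢ² + zᵢ²) / 2` and
`N = ∑ i, εᵢ (wᵢ² - zᵢ²) / 2` (`zonalAverage_eq`). So `T ⟨·, b⟩ ^ k` is a polynomial in `⟨·, b⟩` with
coefficient `𝔼 M ^ k` (`leadingMoment`) in degree `k`: `T` is triangular for the filtration by
degree. For `n = 1`, where there are no two rows, these functions are constant.
Moreover `|M| ≤ 1`, so `𝔼 M ^ k ≤ 𝔼 M ^ 2 = 2 / (n + 2)` for `k ≥ 2`, and `𝔼 M = 0`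
(`leadingMoment_le`). As `T` is symmetric, an induction on the degree gives the bound on polynomials
of mean zero (`symmForm_self_le`).

Polynomials are dense in `L₂`, and `f ↦ ‖P_U f‖` is `1`-Lipschitz uniformly in `U`. This transfers
the bound on `𝔼 ‖P_U f‖` to all of `L₂` (`integral_l2Norm_orthoSymm_le`), and it shows that
`U ↦ ‖P_U f‖` is a uniform limit of continuous functions, hence continuous and integrable.
-/

namespace OrthogonalSymmetrization

/-! ### Sign changes and invariant measures -/

theorem columnBasis_apply {n : ℕ} (U : On n) (i : Fin n) : columnBasis U i = column U i := by
  simp [columnBasis]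

theorem inner_signFlip {n : ℕ} (b : OrthonormalBasis (Fin n) ℝ (EuclideanSpace ℝ (Fin n)))
    (ε : Fin n → ℤˣ) (x y : EuclideanSpace ℝ (Fin n)) :
    inner ℝ (signFlip b ε x) y = ∑ i, ((ε i : ℤ) : ℝ) * (inner ℝ x (b i) * inner ℝ y (b i)) := by
  simp only [signFlip, sum_inner, inner_smul_left, RCLike.conj_to_real]
  refine Finset.sum_congr rfl fun i _ => ?_
  rw [real_inner_comm y (b i)]; ring

/-- `signFlip b ε` as a linear isometry of `ℝⁿ`. -/
noncomputable def signFlipIsometry {n : ℕ}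
    (b : OrthonormalBasis (Fin n) ℝ (EuclideanSpace ℝ (Fin n))) (ε : Fin n → ℤˣ) :
    EuclideanSpace ℝ (Fin n) ≃ₗᵢ[ℝ] EuclideanSpace ℝ (Fin n) :=
  LinearIsometry.toLinearIsometryEquiv
    { toFun := signFlip b ε
      map_add' := fun x y => by
        simp only [signFlip, inner_add_left, mul_add, add_smul, Finset.sum_add_distrib]
      map_smul' := fun c x => by
        simp only [signFlip, inner_smul_left, RCLike.conj_to_real, RingHom.id_apply,
          Finset.smul_sum, smul_smul]
        refine Finset.sum_congr rfl fun i _ => ?_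
        congr 1; ring
      norm_map' := norm_signFlip b ε } rfl

theorem signFlip_signFlip {n : ℕ}
    (b : OrthonormalBasis (Fin n) ℝ (EuclideanSpace ℝ (Fin n))) (ε δ : Fin n → ℤˣ)
    (x : EuclideanSpace ℝ (Fin n)) :
    signFlip b ε (signFlip b δ x) = signFlip b (ε * δ) x := by
  have h (i : Fin n) : inner ℝ (signFlip b δ x) (b i) = ((δ i : ℤ) : ℝ) * inner ℝ x (b i) := by
    simp [signFlip, sum_inner, inner_smul_left, b.inner_eq_ite]
  rw [signFlip]
  simp only [h]
  simp only [signFlip, Pi.mul_apply, Units.val_mul, Int.cast_mul, mul_assoc]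

theorem sphereFlip_sphereFlip {n : ℕ}
    (b : OrthonormalBasis (Fin n) ℝ (EuclideanSpace ℝ (Fin n))) (ε δ : Fin n → ℤˣ) (x : Sph n) :
    sphereFlip b ε (sphereFlip b δ x) = sphereFlip b (ε * δ) x :=
  Subtype.ext (signFlip_signFlip b ε δ x.1)

theorem continuous_sphereFlip {n : ℕ}
    (b : OrthonormalBasis (Fin n) ℝ (EuclideanSpace ℝ (Fin n))) (ε : Fin n → ℤˣ) :
    Continuous (sphereFlip b ε) :=
  ((signFlipIsometry b ε).continuous.comp continuous_subtype_val).subtype_mk _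

theorem sphereFlip_involutive {n : ℕ}
    (b : OrthonormalBasis (Fin n) ℝ (EuclideanSpace ℝ (Fin n))) (ε : Fin n → ℤˣ) :
    Function.Involutive (sphereFlip b ε) := fun x => by
  rw [sphereFlip_sphereFlip]
  apply Subtype.ext
  have h : ε * ε = 1 := by
    ext i; rcases Int.units_eq_one_or (ε i) with h | h <;> simp [h]
  rw [h]
  simp only [sphereFlip, signFlip, Pi.one_apply, Units.val_one, Int.cast_one, one_mul]
  conv_rhs => rw [← b.sum_repr' x.1]
  exact Finset.sum_congr rfl fun i _ => by rw [real_inner_comm]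

/-- The surface measure of a set is the volume of the cone over it, which a linear isometry
preserves. -/
theorem measurePreserving_sphereFlip {n : ℕ}
    (b : OrthonormalBasis (Fin n) ℝ (EuclideanSpace ℝ (Fin n))) (ε : Fin n → ℤˣ) :
    MeasurePreserving (sphereFlip b ε) (sphereProb n) (sphereProb n) := by
  have hm := (continuous_sphereFlip b ε).measurable
  have key : MeasurePreserving (sphereFlip b ε)
      (volume : Measure (EuclideanSpace ℝ (Fin n))).toSphere
      (volume : Measure (EuclideanSpace ℝ (Fin n))).toSphere := by
    refine ⟨hm, Measure.ext fun s hs => ?_⟩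
    rw [Measure.map_apply hm hs, Measure.toSphere_apply' _ (hm hs), Measure.toSphere_apply' _ hs]
    congr 1
    refine Eq.trans ?_ ((signFlipIsometry b ε).measurePreserving.measure_preimage_equiv
      (f := (signFlipIsometry b ε).toHomeomorph.toMeasurableEquiv) _)
    congr 1
    ext y
    simp only [Set.mem_preimage, Set.mem_smul, Set.mem_image]
    constructor
    · rintro ⟨r, hr, _, ⟨x, hx, rfl⟩, rfl⟩
      exact ⟨r, hr, _, ⟨_, hx, rfl⟩, ((signFlipIsometry b ε).map_smul r x.1).symm⟩
    · rintro ⟨r, hr, _, ⟨x, hx, rfl⟩, h⟩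
      change r • x.1 = signFlipIsometry b ε y at h
      refine ⟨r, hr, _, ⟨sphereFlip b ε x, ?_, rfl⟩, ?_⟩
      · rwa [sphereFlip_involutive]
      · apply (signFlipIsometry b ε).injective
        refine Eq.trans ?_ h
        rw [(signFlipIsometry b ε).map_smul]
        exact congrArg (fun z : Sph n => r • z.1) (sphereFlip_involutive b ε x)
  refine ⟨hm, ?_⟩
  rw [sphereProb, Measure.map_smul, key.map_eq]

theorem isProbabilityMeasure_sphereProb {n : ℕ} (hn : 1 ≤ n) :
    IsProbabilityMeasure (sphereProb n) := by
  have : Nontrivial (EuclideanSpace ℝ (Fin n)) :=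
    Module.nontrivial_of_finrank_pos (R := ℝ) (by simpa using Nat.lt_of_lt_of_le one_pos hn)
  constructor
  rw [sphereProb, Measure.smul_apply, smul_eq_mul]
  exact ENNReal.inv_mul_cancel
    (Measure.measure_univ_ne_zero.2 (Measure.toSphere_ne_zero _)) (measure_ne_top _ _)

instance isProbabilityMeasure_haarOn (n : ℕ) : IsProbabilityMeasure (haarOn n) :=
  ⟨by simpa [haarOn] using Measure.haarMeasure_self (G := On n) (K₀ := ⊤)⟩

instance isMulLeftInvariant_haarOn (n : ℕ) : (haarOn n).IsMulLeftInvariant := by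
  unfold haarOn; infer_instance

/-! ### The symmetrization on `L₂` -/

theorem orthoSymm_add {n : ℕ} (b : OrthonormalBasis (Fin n) ℝ (EuclideanSpace ℝ (Fin n)))
    (f g : Sph n → ℝ) : orthoSymm b (f + g) = orthoSymm b f + orthoSymm b g := by
  funext x
  simp [orthoSymm, Finset.sum_add_distrib, add_div]

theorem orthoSymm_sub {n : ℕ} (b : OrthonormalBasis (Fin n) ℝ (EuclideanSpace ℝ (Fin n)))
    (f g : Sph n → ℝ) : orthoSymm b (f - g) = orthoSymm b f - orthoSymm b g := by
  funext x
  simp [orthoSymm, Finset.sum_sub_distrib, sub_div]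

theorem orthoSymm_smul {n : ℕ} (b : OrthonormalBasis (Fin n) ℝ (EuclideanSpace ℝ (Fin n)))
    (c : ℝ) (f : Sph n → ℝ) : orthoSymm b (c • f) = c • orthoSymm b f := by
  funext x
  simp [orthoSymm, ← Finset.mul_sum, mul_div_assoc]

theorem orthoSymm_eq_smul_sum {n : ℕ}
    (b : OrthonormalBasis (Fin n) ℝ (EuclideanSpace ℝ (Fin n))) (f : Sph n → ℝ) :
    orthoSymm b f = ((2 : ℝ) ^ n)⁻¹ • ∑ ε : Fin n → ℤˣ, f ∘ sphereFlip b ε := by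
  funext x
  simp [orthoSymm, div_eq_inv_mul]

theorem card_signs (n : ℕ) : (Fintype.card (Fin n → ℤˣ) : ℝ) = 2 ^ n := by
  simp

/-- The symmetrization is idempotent: the sign changes form a group. -/
theorem orthoSymm_orthoSymm {n : ℕ}
    (b : OrthonormalBasis (Fin n) ℝ (EuclideanSpace ℝ (Fin n))) (f : Sph n → ℝ) :
    orthoSymm b (orthoSymm b f) = orthoSymm b f := by
  funext x
  have h (δ : Fin n → ℤˣ) : orthoSymm b f (sphereFlip b δ x) = orthoSymm b f x := by
    simp only [orthoSymm, sphereFlip_sphereFlip]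
    congr 1
    exact Fintype.sum_equiv (Equiv.mulRight δ) _ _ fun _ => rfl
  rw [orthoSymm]
  simp only [h, Finset.sum_const, Finset.card_univ, nsmul_eq_mul, card_signs]
  field_simp

theorem memLp_orthoSymm {n : ℕ} (b : OrthonormalBasis (Fin n) ℝ (EuclideanSpace ℝ (Fin n)))
    {f : Sph n → ℝ} (hf : MemLp f 2 (sphereProb n)) :
    MemLp (orthoSymm b f) 2 (sphereProb n) := by
  rw [orthoSymm_eq_smul_sum]
  exact (memLp_finsetSum' _ fun ε _ =>
    hf.comp_measurePreserving (measurePreserving_sphereFlip b ε)).const_smul _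

theorem l2Norm_nonneg {n : ℕ} (f : Sph n → ℝ) : 0 ≤ l2Norm f := ENNReal.toReal_nonneg

theorem eLpNorm_orthoSymm_le {n : ℕ}
    (b : OrthonormalBasis (Fin n) ℝ (EuclideanSpace ℝ (Fin n)))
    {f : Sph n → ℝ} (hf : MemLp f 2 (sphereProb n)) :
    eLpNorm (orthoSymm b f) 2 (sphereProb n) ≤ eLpNorm f 2 (sphereProb n) := by
  rw [orthoSymm_eq_smul_sum, eLpNorm_const_smul]
  have h1 (ε : Fin n → ℤˣ) :
      eLpNorm (f ∘ sphereFlip b ε) 2 (sphereProb n) = eLpNorm f 2 (sphereProb n) :=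
    eLpNorm_comp_measurePreserving hf.aestronglyMeasurable (measurePreserving_sphereFlip b ε)
  have h2 : eLpNorm (∑ ε : Fin n → ℤˣ, f ∘ sphereFlip b ε) 2 (sphereProb n)
      ≤ ∑ ε : Fin n → ℤˣ, eLpNorm (f ∘ sphereFlip b ε) 2 (sphereProb n) :=
    eLpNorm_sum_le (fun ε _ => (hf.comp_measurePreserving
      (measurePreserving_sphereFlip b ε)).aestronglyMeasurable) (by norm_num)
  simp only [h1, Finset.sum_const, Finset.card_univ, nsmul_eq_mul] at h2
  refine (mul_le_mul_right h2 _).trans ?_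
  rw [← mul_assoc]
  refine (mul_le_mul_left (le_of_eq ?_) _).trans (one_mul _).le
  rw [Real.enorm_eq_ofReal (by positivity), ENNReal.ofReal_inv_of_pos (by positivity),
    ← ENNReal.ofReal_natCast, card_signs]
  exact ENNReal.inv_mul_cancel (by simp) ENNReal.ofReal_ne_top

theorem l2Norm_orthoSymm_le {n : ℕ}
    (b : OrthonormalBasis (Fin n) ℝ (EuclideanSpace ℝ (Fin n)))
    {f : Sph n → ℝ} (hf : MemLp f 2 (sphereProb n)) : l2Norm (orthoSymm b f) ≤ l2Norm f :=
  ENNReal.toReal_mono hf.eLpNorm_ne_top (eLpNorm_orthoSymm_le b hf)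

theorem l2Norm_add_le {n : ℕ} {f g : Sph n → ℝ} (hf : MemLp f 2 (sphereProb n))
    (hg : MemLp g 2 (sphereProb n)) : l2Norm (f + g) ≤ l2Norm f + l2Norm g := by
  rw [l2Norm, l2Norm, l2Norm, ← ENNReal.toReal_add hf.eLpNorm_ne_top hg.eLpNorm_ne_top]
  exact ENNReal.toReal_mono (ENNReal.add_ne_top.2 ⟨hf.eLpNorm_ne_top, hg.eLpNorm_ne_top⟩)
    (eLpNorm_add_le hf.aestronglyMeasurable hg.aestronglyMeasurable (by norm_num))

theorem l2Norm_sub_comm {n : ℕ} (f g : Sph n → ℝ) : l2Norm (f - g) = l2Norm (g - f) := by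
  rw [l2Norm, l2Norm, eLpNorm_sub_comm]

theorem l2Norm_le_add_sub {n : ℕ} {f g : Sph n → ℝ} (hf : MemLp f 2 (sphereProb n))
    (hg : MemLp g 2 (sphereProb n)) : l2Norm f ≤ l2Norm g + l2Norm (f - g) := by
  simpa using l2Norm_add_le hg (hf.sub hg)

theorem l2Norm_orthoSymm_le_add_sub {n : ℕ}
    (b : OrthonormalBasis (Fin n) ℝ (EuclideanSpace ℝ (Fin n)))
    {f g : Sph n → ℝ} (hf : MemLp f 2 (sphereProb n)) (hg : MemLp g 2 (sphereProb n)) :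
    l2Norm (orthoSymm b f) ≤ l2Norm (orthoSymm b g) + l2Norm (f - g) := by
  refine (l2Norm_le_add_sub (memLp_orthoSymm b hf) (memLp_orthoSymm b hg)).trans ?_
  rw [← orthoSymm_sub]
  exact add_le_add_right (l2Norm_orthoSymm_le b (hf.sub hg)) _

theorem l2Norm_sq {n : ℕ} {f : Sph n → ℝ} (hf : MemLp f 2 (sphereProb n)) :
    l2Norm f ^ 2 = ∫ x, f x * f x ∂sphereProb n := by
  have h := hf.eLpNorm_eq_integral_rpow_norm (by norm_num) (by norm_num)
  rw [l2Norm, h, ENNReal.toReal_ofReal (by positivity)]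
  have h0 : 0 ≤ ∫ x, f x * f x ∂sphereProb n := integral_nonneg fun x => mul_self_nonneg _
  have h1 : ∫ x, ‖f x‖ ^ (2 : ENNReal).toReal ∂sphereProb n = ∫ x, f x * f x ∂sphereProb n := by
    refine integral_congr_ae (.of_forall fun x => ?_)
    simp [← sq]
  rw [h1, ← Real.rpow_natCast, ← Real.rpow_mul h0]
  simp

/-- The symmetrization is a symmetric operator on `L₂`. -/
theorem integral_orthoSymm_mul {n : ℕ}
    (b : OrthonormalBasis (Fin n) ℝ (EuclideanSpace ℝ (Fin n)))
    {f g : Sph n → ℝ} (hf : MemLp f 2 (sphereProb n)) (hg : MemLp g 2 (sphereProb n)) :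
    ∫ x, orthoSymm b f x * g x ∂sphereProb n = ∫ x, f x * orthoSymm b g x ∂sphereProb n := by
  simp only [orthoSymm, div_mul_eq_mul_div, mul_div_assoc', integral_div, Finset.sum_mul,
    Finset.mul_sum]
  have hP (ε : Fin n → ℤˣ) := measurePreserving_sphereFlip b ε
  have h1 (ε : Fin n → ℤˣ) : Integrable (fun x => f (sphereFlip b ε x) * g x) (sphereProb n) :=
    (hf.comp_measurePreserving (hP ε)).integrable_mul hg
  have h2 (ε : Fin n → ℤˣ) : Integrable (fun x => f x * g (sphereFlip b ε x)) (sphereProb n) :=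
    hf.integrable_mul (hg.comp_measurePreserving (hP ε))
  rw [integral_finsetSum _ fun ε _ => h1 ε, integral_finsetSum _ fun ε _ => h2 ε]
  congr 1
  refine Finset.sum_congr rfl fun ε _ => ?_
  have hemb : MeasurableEmbedding (sphereFlip b ε) :=
    (MeasurableEquiv.ofInvolutive _ (sphereFlip_involutive b ε)
      (hP ε).measurable).measurableEmbedding
  rw [← (hP ε).integral_comp hemb fun x => f (sphereFlip b ε x) * g x]
  simp only [sphereFlip_involutive b ε _]

theorem l2Norm_orthoSymm_sq {n : ℕ}
    (b : OrthonormalBasis (Fin n) ℝ (EuclideanSpace ℝ (Fin n)))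
    {f : Sph n → ℝ} (hf : MemLp f 2 (sphereProb n)) :
    l2Norm (orthoSymm b f) ^ 2 = ∫ x, orthoSymm b f x * f x ∂sphereProb n := by
  rw [l2Norm_sq (memLp_orthoSymm b hf), ← integral_orthoSymm_mul b (memLp_orthoSymm b hf) hf,
    orthoSymm_orthoSymm]

theorem continuous_column {n : ℕ} (i : Fin n) : Continuous fun U : On n => column U i := by
  have h : Continuous fun U : On n => U.1 := continuous_subtype_val
  exact (PiLp.continuous_toLp 2 _).comp
    (continuous_pi fun j => (continuous_apply_apply j i).comp h)

/-- Joint continuity, in the basis and in the point, of the symmetrization of a continuous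
function. -/
theorem continuous_uncurry_orthoSymm {n : ℕ} {f : Sph n → ℝ} (hf : Continuous f) :
    Continuous fun p : On n × Sph n => orthoSymm (columnBasis p.1) f p.2 := by
  refine (continuous_finsetSum _ fun ε _ => hf.comp ?_).div_const _
  refine Continuous.subtype_mk ?_ _
  simp only [signFlip, columnBasis_apply]
  have hc (i : Fin n) : Continuous fun p : On n × Sph n => column p.1 i :=
    (continuous_column i).comp continuous_fst
  have hs : Continuous fun p : On n × Sph n => (p.2 : EuclideanSpace ℝ (Fin n)) :=
    continuous_subtype_val.comp continuous_snd
  exact continuous_finsetSum _ fun i _ => Continuous.smul (continuous_const.mul (hs.inner (𝕜 := ℝ) (hc i))) (hc i)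

/-! ### Signs -/

theorem sum_signs_mul_eq_zero {n : ℕ} {i j : Fin n} (hij : i ≠ j) :
    ∑ ε : Fin n → ℤˣ, ((ε i : ℤ) : ℝ) * ((ε j : ℤ) : ℝ) = 0 := by
  have h : ∑ ε : Fin n → ℤˣ, ((ε i : ℤ) : ℝ) * ((ε j : ℤ) : ℝ)
      = ∑ ε : Fin n → ℤˣ, -(((ε i : ℤ) : ℝ) * ((ε j : ℤ) : ℝ)) := by
    refine Fintype.sum_equiv (Equiv.mulRight (Pi.mulSingle i (-1))) _ _ fun ε => ?_
    simp [Pi.mulSingle_eq_of_ne' hij]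
  rw [Finset.sum_neg_distrib] at h
  linarith

theorem sum_signs_sum_mul (n : ℕ) (r : Fin n → ℝ) :
    ∑ ε : Fin n → ℤˣ, ∑ i, ((ε i : ℤ) : ℝ) * r i = 0 := by
  have h : ∑ ε : Fin n → ℤˣ, ∑ i, ((ε i : ℤ) : ℝ) * r i
      = ∑ ε : Fin n → ℤˣ, -∑ i, ((ε i : ℤ) : ℝ) * r i := by
    refine Fintype.sum_equiv (Equiv.mulRight (-1)) _ _ fun ε => ?_
    simp
  rw [Finset.sum_neg_distrib] at h
  linarith

theorem sum_signs_sum_mul_sq (n : ℕ) (r : Fin n → ℝ) :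
    ∑ ε : Fin n → ℤˣ, (∑ i, ((ε i : ℤ) : ℝ) * r i) ^ 2 = 2 ^ n * ∑ i, r i ^ 2 := by
  have h (i j : Fin n) : ∑ ε : Fin n → ℤˣ, ((ε i : ℤ) : ℝ) * r i * (((ε j : ℤ) : ℝ) * r j)
      = if i = j then 2 ^ n * r i ^ 2 else 0 := by
    split_ifs with hij
    · subst hij
      have h1 (ε : Fin n → ℤˣ) : ((ε i : ℤ) : ℝ) * r i * (((ε i : ℤ) : ℝ) * r i) = r i ^ 2 := by
        rcases Int.units_eq_one_or (ε i) with h | h <;> simp [h, sq]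
      simp only [h1, Finset.sum_const, Finset.card_univ, nsmul_eq_mul, card_signs]
    · have h1 (ε : Fin n → ℤˣ) : ((ε i : ℤ) : ℝ) * r i * (((ε j : ℤ) : ℝ) * r j)
          = ((ε i : ℤ) : ℝ) * ((ε j : ℤ) : ℝ) * (r i * r j) := by ring
      simp only [h1, ← Finset.sum_mul, sum_signs_mul_eq_zero hij, zero_mul]
  simp only [sq, Finset.sum_mul_sum]
  rw [Finset.sum_comm]
  simp only [Finset.sum_comm (s := (Finset.univ : Finset (Fin n → ℤˣ)))]
  simp only [h, Finset.sum_ite_eq, Finset.mem_univ, if_true, Finset.mul_sum, sq]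

/-! ### Integrals over the orthogonal group -/

theorem integrable_haarOn {n : ℕ} {F : On n → ℝ} (hF : Continuous F) :
    Integrable F (haarOn n) :=
  hF.integrable_of_hasCompactSupport (HasCompactSupport.of_compactSpace _)

theorem continuous_entry {n : ℕ} (i j : Fin n) : Continuous fun U : On n => U.1 i j := by
  have h : Continuous fun U : On n => U.1 := continuous_subtype_val
  exact (continuous_apply_apply i j).comp h

/-- Pairwise orthogonal vectors, some of which may vanish, are multiples of an orthonormal basis. -/
theorem exists_orthonormalBasis_norm_smul {n : ℕ} {v : Fin n → EuclideanSpace ℝ (Fin n)}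
    (hv : Pairwise fun i j => inner ℝ (v i) (v j) = 0) :
    ∃ b : OrthonormalBasis (Fin n) ℝ (EuclideanSpace ℝ (Fin n)), ∀ i, v i = ‖v i‖ • b i := by
  have hon : Orthonormal ℝ (({i | v i ≠ 0} : Set (Fin n)).domRestrict fun i => ‖v i‖⁻¹ • v i) := by
    refine ⟨fun i => ?_, fun i j hij => ?_⟩
    · have : ‖v i‖ ≠ 0 := norm_ne_zero_iff.2 i.2
      simp [Set.domRestrict_apply, norm_smul, this]
    · have : inner ℝ (v i) (v j) = 0 := hv fun h => hij (Subtype.ext h)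
      simp [Set.domRestrict_apply, inner_smul_left, inner_smul_right, this]
  obtain ⟨b, hb⟩ := hon.exists_orthonormalBasis_extension_of_card_eq (by simp)
  refine ⟨b, fun i => ?_⟩
  by_cases hi : v i = 0
  · simp [hi]
  · rw [hb i hi, smul_smul, mul_inv_cancel₀ (norm_ne_zero_iff.2 hi), one_smul]

theorem exists_orthonormalBasis_eq_norm_smul {n : ℕ} (j : Fin n) (p : EuclideanSpace ℝ (Fin n)) :
    ∃ b : OrthonormalBasis (Fin n) ℝ (EuclideanSpace ℝ (Fin n)), p = ‖p‖ • b j := by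
  obtain ⟨b, hb⟩ := exists_orthonormalBasis_norm_smul (v := Pi.single j p) (by
    intro k l hkl
    by_cases hk : k = j
    · simp [Pi.single_eq_of_ne (show l ≠ j from fun h => hkl (hk.trans h.symm))]
    · simp [Pi.single_eq_of_ne hk])
  exact ⟨b, by simpa using hb j⟩

/-- Invariance of Haar measure, in coordinates: the matrix of the columns of a random orthogonal
matrix has the same distribution in every orthonormal basis. -/
theorem integral_inner_column {n : ℕ}
    (b : OrthonormalBasis (Fin n) ℝ (EuclideanSpace ℝ (Fin n))) (G : (Fin n → Fin n → ℝ) → ℝ) :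
    ∫ U : On n, G (fun j i => inner ℝ (b j) (column U i)) ∂haarOn n
      = ∫ U : On n, G (fun j i => U.1 j i) ∂haarOn n := by
  let g : On n := ⟨Matrix.of fun i j => b j i, by
    rw [Matrix.mem_orthogonalGroup_iff']
    ext i j
    have h := b.inner_eq_ite i j
    rw [PiLp.inner_apply] at h
    simpa [Matrix.mul_apply, Matrix.one_apply, mul_comm] using h⟩
  rw [← integral_mul_left_eq_self (fun U : On n => G fun j i => U.1 j i) g⁻¹]
  refine integral_congr_ae (.of_forall fun U => ?_)
  refine congrArg G (funext fun j => funext fun i => ?_)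
  change _ = (star g.1 * U.1) j i
  simp [Matrix.mul_apply, Matrix.star_apply, g, column, PiLp.inner_apply, mul_comm]

theorem inner_basis_column {n : ℕ} (U : On n) (i j : Fin n) :
    inner ℝ (EuclideanSpace.basisFun (Fin n) ℝ j) (column U i) = U.1 j i := by
  simp [column, EuclideanSpace.inner_single_left]

theorem sum_entry_sq_column {n : ℕ} (U : On n) (i : Fin n) : ∑ j, U.1 j i ^ 2 = 1 := by
  have h := (orthonormal_column U).1 i
  have h2 := EuclideanSpace.real_norm_sq_eq (column U i)
  rw [h] at h2
  simpa [column] using h2.symm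

theorem sum_entry_sq_row {n : ℕ} (U : On n) (j : Fin n) : ∑ i, U.1 j i ^ 2 = 1 := by
  have h := congrFun (congrFun ((Matrix.mem_orthogonalGroup_iff (Fin n) ℝ).1 U.2) j) j
  simpa [Matrix.mul_apply, sq] using h

theorem integral_inner_column_pow_four {n : ℕ} (i j : Fin n) (p : EuclideanSpace ℝ (Fin n)) :
    ∫ U : On n, inner ℝ p (column U i) ^ 4 ∂haarOn n
      = ‖p‖ ^ 4 * ∫ U : On n, U.1 j i ^ 4 ∂haarOn n := by
  obtain ⟨b, hp⟩ := exists_orthonormalBasis_eq_norm_smul j p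
  rw [← integral_inner_column b fun W => W j i ^ 4, ← integral_const_mul]
  refine integral_congr_ae (.of_forall fun U => ?_)
  simp only
  conv_lhs => rw [hp, inner_smul_left]
  simp [mul_pow]

/-- The fourth moments along `e a + e b` and `e a - e b` are both `4` times the one along `e a`;
adding the two isolates the mixed moment. -/
theorem integral_entry_sq_mul_sq {n : ℕ} (i : Fin n) {a b : Fin n} (hab : a ≠ b) :
    ∫ U : On n, U.1 a i ^ 2 * U.1 b i ^ 2 ∂haarOn n
      = (∫ U : On n, U.1 a i ^ 4 ∂haarOn n) / 3 := by
  set e := EuclideanSpace.basisFun (Fin n) ℝ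
  have hsq (s : ℝ) (hs : s ^ 2 = 1) : ‖e a + s • e b‖ ^ 4 = 4 := by
    have h : ‖e a + s • e b‖ ^ 2 = 2 := by
      rw [norm_add_sq_real, norm_smul, inner_smul_right, e.inner_eq_ite]
      simp [hab, hs]; norm_num
    calc ‖e a + s • e b‖ ^ 4 = (‖e a + s • e b‖ ^ 2) ^ 2 := by ring
      _ = 4 := by rw [h]; norm_num
  have h1 := integral_inner_column_pow_four i a (e a + (1 : ℝ) • e b)
  have h2 := integral_inner_column_pow_four i a (e a + (-1 : ℝ) • e b)
  have h3 := integral_inner_column_pow_four i a (e b)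
  rw [hsq _ (by norm_num)] at h1 h2
  simp only [inner_add_left, inner_smul_left, e, inner_basis_column, RCLike.conj_to_real] at h1 h2 h3
  simp only [OrthonormalBasis.norm_eq_one, one_pow, one_mul] at h3
  have c := @continuous_entry n
  have i1 : Integrable (fun U : On n => (U.1 a i + 1 * U.1 b i) ^ 4) (haarOn n) :=
    integrable_haarOn (((c a i).add (continuous_const.mul (c b i))).pow 4)
  have i2 : Integrable (fun U : On n => (U.1 a i + -1 * U.1 b i) ^ 4) (haarOn n) :=
    integrable_haarOn (((c a i).add (continuous_const.mul (c b i))).pow 4)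
  have i3 : Integrable (fun U : On n => 2 * U.1 a i ^ 4) (haarOn n) :=
    integrable_haarOn (continuous_const.mul ((c a i).pow 4))
  have i4 : Integrable (fun U : On n => 2 * U.1 b i ^ 4) (haarOn n) :=
    integrable_haarOn (continuous_const.mul ((c b i).pow 4))
  have i5 : Integrable (fun U : On n => 12 * (U.1 a i ^ 2 * U.1 b i ^ 2)) (haarOn n) :=
    integrable_haarOn (continuous_const.mul (((c a i).pow 2).mul ((c b i).pow 2)))
  have i34 : Integrable (fun U : On n => 2 * U.1 a i ^ 4 + 2 * U.1 b i ^ 4) (haarOn n) := i3.add i4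
  have h4 : ∫ U : On n, (U.1 a i + 1 * U.1 b i) ^ 4 + (U.1 a i + -1 * U.1 b i) ^ 4 ∂haarOn n
      = ∫ U : On n, 2 * U.1 a i ^ 4 + 2 * U.1 b i ^ 4 + 12 * (U.1 a i ^ 2 * U.1 b i ^ 2)
        ∂haarOn n := by
    refine integral_congr_ae (.of_forall fun U => ?_)
    simp only; ring
  rw [integral_add i1 i2, h1, h2, integral_add i34 i5, integral_add i3 i4,
    integral_const_mul, integral_const_mul, integral_const_mul, h3] at h4
  linarith

/-- Column `i` is a unit vector, so the products `U b i ^ 2 * U c i ^ 2` add up to `1` over all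
pairs `b`, `c`; by `integral_entry_sq_mul_sq` this determines the fourth moment. -/
theorem integral_entry_pow_four {n : ℕ} (i a : Fin n) :
    ∫ U : On n, U.1 a i ^ 4 ∂haarOn n = 3 / (n * (n + 2)) := by
  have hn : (0 : ℝ) < n := by exact_mod_cast (Fin.pos a)
  set m := ∫ U : On n, U.1 a i ^ 4 ∂haarOn n with hm
  have h4 (b : Fin n) : ∫ U : On n, U.1 b i ^ 4 ∂haarOn n = m := by
    have h := integral_inner_column_pow_four i a (EuclideanSpace.basisFun (Fin n) ℝ b)
    simpa only [inner_basis_column, OrthonormalBasis.norm_eq_one, one_pow, one_mul] using h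
  have h2 (b c : Fin n) : ∫ U : On n, U.1 b i ^ 2 * U.1 c i ^ 2 ∂haarOn n
      = m / 3 + if b = c then 2 * m / 3 else 0 := by
    split_ifs with hbc
    · subst hbc
      simp only [← pow_add, Nat.reduceAdd, h4]; ring
    · rw [integral_entry_sq_mul_sq i hbc, h4]; ring
  have hI (b c : Fin n) : Integrable (fun U : On n => U.1 b i ^ 2 * U.1 c i ^ 2) (haarOn n) :=
    integrable_haarOn (((continuous_entry b i).pow 2).mul ((continuous_entry c i).pow 2))
  have hsum : ∑ b, ∑ c, ∫ U : On n, U.1 b i ^ 2 * U.1 c i ^ 2 ∂haarOn n = 1 := by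
    have h (b : Fin n) : ∑ c, ∫ U : On n, U.1 b i ^ 2 * U.1 c i ^ 2 ∂haarOn n
        = ∫ U : On n, ∑ c, U.1 b i ^ 2 * U.1 c i ^ 2 ∂haarOn n :=
      (integral_finsetSum _ fun c _ => hI b c).symm
    simp only [h]
    rw [← integral_finsetSum _ fun b _ => integrable_finsetSum _ fun c _ => hI b c]
    simp only [← Finset.mul_sum, sum_entry_sq_column, mul_one]
    simp
  simp only [h2, Finset.sum_add_distrib, Finset.sum_const, Finset.card_univ, Fintype.card_fin,
    nsmul_eq_mul, Finset.sum_ite_eq, Finset.mem_univ, if_true] at hsum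
  rw [eq_div_iff (by positivity)]
  linarith

theorem integral_entry_sq_add_sq_sq {n : ℕ} (i : Fin n) {a b : Fin n} (hab : a ≠ b) :
    ∫ U : On n, (U.1 a i ^ 2 + U.1 b i ^ 2) ^ 2 ∂haarOn n = 8 / (n * (n + 2)) := by
  have c := @continuous_entry n
  have h : ∫ U : On n, (U.1 a i ^ 2 + U.1 b i ^ 2) ^ 2 ∂haarOn n
      = ∫ U : On n, U.1 a i ^ 4 + U.1 b i ^ 4 + 2 * (U.1 a i ^ 2 * U.1 b i ^ 2) ∂haarOn n := by
    refine integral_congr_ae (.of_forall fun U => ?_)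
    simp only; ring
  have i3 : Integrable (fun U : On n => U.1 a i ^ 4) (haarOn n) :=
    integrable_haarOn ((c a i).pow 4)
  have i4 : Integrable (fun U : On n => U.1 b i ^ 4) (haarOn n) :=
    integrable_haarOn ((c b i).pow 4)
  have i34 : Integrable (fun U : On n => U.1 a i ^ 4 + U.1 b i ^ 4) (haarOn n) := i3.add i4
  have i5 : Integrable (fun U : On n => 2 * (U.1 a i ^ 2 * U.1 b i ^ 2)) (haarOn n) :=
    integrable_haarOn (continuous_const.mul (((c a i).pow 2).mul ((c b i).pow 2)))
  rw [h, integral_add i34 i5, integral_add i3 i4, integral_const_mul,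
    integral_entry_sq_mul_sq i hab, integral_entry_pow_four, integral_entry_pow_four]
  ring

/-! ### Zonal averages -/

/-- The average over `U ∈ O(n)` and over the signs of `⟨signFlip x, y⟩ ^ k`: the value at `x` of
the averaged symmetrization of `⟨·, y⟩ ^ k`. -/
noncomputable def zonalAverage {n : ℕ} (k : ℕ) (x y : EuclideanSpace ℝ (Fin n)) : ℝ :=
  ∫ U : On n, (∑ ε : Fin n → ℤˣ,
    (∑ i, ((ε i : ℤ) : ℝ) * (inner ℝ x (column U i) * inner ℝ y (column U i))) ^ k) / 2 ^ n
    ∂haarOn n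

/-- The scalar by which the averaged symmetrization acts on polynomials of degree `k` modulo
polynomials of smaller degree; `a ≠ b` are any two row indices. -/
noncomputable def leadingMoment {n : ℕ} (a b : Fin n) (k : ℕ) : ℝ :=
  ∫ U : On n, (∑ ε : Fin n → ℤˣ,
    (∑ i, ((ε i : ℤ) : ℝ) * ((U.1 a i ^ 2 + U.1 b i ^ 2) / 2)) ^ k) / 2 ^ n ∂haarOn n

theorem continuous_sum_signs {n : ℕ} {r : On n → Fin n → ℝ}
    (hr : ∀ i, Continuous fun U => r U i) (ε : Fin n → ℤˣ) :
    Continuous fun U => ∑ i, ((ε i : ℤ) : ℝ) * r U i :=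
  continuous_finsetSum _ fun i _ => continuous_const.mul (hr i)

/-- The signed sums have absolute value at most `1`, because the rows of `U` are unit vectors.
Hence their moments of order `k ≥ 2` are at most the second one, which is `2 / (n + 2)`; the first
moment vanishes. -/
theorem leadingMoment_le {n : ℕ} {a b : Fin n} (hab : a ≠ b) {k : ℕ} (hk : 1 ≤ k) :
    leadingMoment a b k ≤ 2 / (n + 2) := by
  have hn : (0 : ℝ) < n := by exact_mod_cast (Fin.pos a)
  have hr (i : Fin n) : Continuous fun U : On n => (U.1 a i ^ 2 + U.1 b i ^ 2) / 2 :=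
    (((continuous_entry a i).pow 2).add ((continuous_entry b i).pow 2)).div_const 2
  obtain rfl | hk2 : k = 1 ∨ 2 ≤ k := by omega
  · have h : leadingMoment a b 1 = 0 := by
      simp only [leadingMoment, pow_one, sum_signs_sum_mul, zero_div, integral_zero]
    rw [h]; positivity
  have hcont (m : ℕ) : Continuous fun U : On n => (∑ ε : Fin n → ℤˣ,
      (∑ i, ((ε i : ℤ) : ℝ) * ((U.1 a i ^ 2 + U.1 b i ^ 2) / 2)) ^ m) / 2 ^ n :=
    (continuous_finsetSum _ fun ε _ => (continuous_sum_signs hr ε).pow m).div_const _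
  have hle : leadingMoment a b k ≤ leadingMoment a b 2 := by
    refine integral_mono (integrable_haarOn (hcont k)) (integrable_haarOn (hcont 2)) fun U => ?_
    refine div_le_div_of_nonneg_right (Finset.sum_le_sum fun ε _ => ?_) (by positivity)
    set t := ∑ i, ((ε i : ℤ) : ℝ) * ((U.1 a i ^ 2 + U.1 b i ^ 2) / 2)
    have ht : |t| ≤ 1 := by
      refine (Finset.abs_sum_le_sum_abs _ _).trans ?_
      have h1 (i : Fin n) : |((ε i : ℤ) : ℝ) * ((U.1 a i ^ 2 + U.1 b i ^ 2) / 2)|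
          = (U.1 a i ^ 2 + U.1 b i ^ 2) / 2 := by
        have h0 : 0 ≤ (U.1 a i ^ 2 + U.1 b i ^ 2) / 2 := by positivity
        rcases Int.units_eq_one_or (ε i) with h | h <;> simp [h, abs_of_nonneg h0]
      simp only [h1]
      rw [← Finset.sum_div, Finset.sum_add_distrib, sum_entry_sq_row, sum_entry_sq_row]
      norm_num
    calc t ^ k ≤ |t| ^ k := by rw [← abs_pow]; exact le_abs_self _
      _ ≤ |t| ^ 2 := pow_le_pow_of_le_one (abs_nonneg _) ht hk2
      _ = t ^ 2 := sq_abs t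
  refine hle.trans (le_of_eq ?_)
  have h2 : leadingMoment a b 2
      = ∑ i, ∫ U : On n, (U.1 a i ^ 2 + U.1 b i ^ 2) ^ 2 / 4 ∂haarOn n := by
    rw [leadingMoment, ← integral_finsetSum]
    · refine integral_congr_ae (.of_forall fun U => ?_)
      simp only
      rw [sum_signs_sum_mul_sq, mul_div_assoc, mul_div_cancel₀ _ (by positivity)]
      refine Finset.sum_congr rfl fun i _ => ?_
      ring
    · intro i _
      exact integrable_haarOn ((((continuous_entry a i).pow 2).add
        ((continuous_entry b i).pow 2)).pow 2 |>.div_const 4)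
  simp only [h2, integral_div, integral_entry_sq_add_sq_sq _ hab, Finset.sum_const,
    Finset.card_univ, Fintype.card_fin, nsmul_eq_mul]
  field_simp
  norm_num

/-- Placing `x` and `y` symmetrically about the axes `p ∥ x + y` and `q ∥ y - x`, the products
`⟨x, vᵢ⟩⟨y, vᵢ⟩` are differences of squares `⟨p, vᵢ⟩² - ⟨q, vᵢ⟩²`, which are affine in `⟨x, y⟩`. -/
theorem zonalAverage_eq {n : ℕ} {a b : Fin n} (hab : a ≠ b) (k : ℕ)
    {x y : EuclideanSpace ℝ (Fin n)} (hx : ‖x‖ = 1) (hy : ‖y‖ = 1) :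
    zonalAverage k x y = ∫ U : On n, (∑ ε : Fin n → ℤˣ,
      (inner ℝ x y * (∑ i, ((ε i : ℤ) : ℝ) * ((U.1 a i ^ 2 + U.1 b i ^ 2) / 2))
        + ∑ i, ((ε i : ℤ) : ℝ) * ((U.1 a i ^ 2 - U.1 b i ^ 2) / 2)) ^ k) / 2 ^ n ∂haarOn n := by
  set p := (2 : ℝ)⁻¹ • (y + x) with hp
  set q := (2 : ℝ)⁻¹ • (y - x) with hq
  have hpq : inner ℝ p q = 0 := by
    rw [hp, hq, inner_smul_left, inner_smul_right]
    simp [(real_inner_add_sub_eq_zero_iff y x).2 (hy.trans hx.symm)]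
  have hp2 : ‖p‖ ^ 2 = (1 + inner ℝ x y) / 2 := by
    rw [hp, norm_smul, mul_pow, norm_add_sq_real, hx, hy, real_inner_comm x y]; norm_num; ring
  have hq2 : ‖q‖ ^ 2 = (1 - inner ℝ x y) / 2 := by
    rw [hq, norm_smul, mul_pow, norm_sub_sq_real, hx, hy, real_inner_comm x y]; norm_num; ring
  obtain ⟨B, hB⟩ := exists_orthonormalBasis_norm_smul
    (v := fun i => if i = a then p else if i = b then q else 0) (by
      intro i j hij
      by_cases hia : i = a
      · have hja : j ≠ a := fun h => hij (hia.trans h.symm)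
        by_cases hjb : j = b <;> simp [hia, hja, hjb, hpq, hab.symm]
      · by_cases hib : i = b
        · have hjb : j ≠ b := fun h => hij (hib.trans h.symm)
          by_cases hja : j = a <;>
            simp [hib, hja, hjb, hab.symm, real_inner_comm p q, hpq]
        · simp [hia, hib])
  have hBp : p = ‖p‖ • B a := by simpa using hB a
  have hBq : q = ‖q‖ • B b := by simpa [hab.symm] using hB b
  have hxpq : x = p - q := by rw [hp, hq]; module
  have hypq : y = p + q := by rw [hp, hq]; module
  rw [zonalAverage, ← integral_inner_column B fun W => (∑ ε : Fin n → ℤˣ,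
      (inner ℝ x y * (∑ i, ((ε i : ℤ) : ℝ) * ((W a i ^ 2 + W b i ^ 2) / 2))
        + ∑ i, ((ε i : ℤ) : ℝ) * ((W a i ^ 2 - W b i ^ 2) / 2)) ^ k) / 2 ^ n]
  refine integral_congr_ae (.of_forall fun U => ?_)
  simp only
  congr 1
  refine Finset.sum_congr rfl fun ε _ => ?_
  congr 1
  rw [Finset.mul_sum, ← Finset.sum_add_distrib]
  refine Finset.sum_congr rfl fun i _ => ?_
  have h1 : inner ℝ x (column U i) * inner ℝ y (column U i)
      = ‖p‖ ^ 2 * inner ℝ (B a) (column U i) ^ 2 - ‖q‖ ^ 2 * inner ℝ (B b) (column U i) ^ 2 := by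
    have e1 : inner ℝ p (column U i) = ‖p‖ * inner ℝ (B a) (column U i) := by
      conv_lhs => rw [hBp, inner_smul_left]
      simp
    have e2 : inner ℝ q (column U i) = ‖q‖ * inner ℝ (B b) (column U i) := by
      conv_lhs => rw [hBq, inner_smul_left]
      simp
    calc _ = inner ℝ (p - q) (column U i) * inner ℝ (p + q) (column U i) := by
          rw [← hxpq, ← hypq]
      _ = _ := by rw [inner_sub_left, inner_add_left, e1, e2]; ring
  rw [h1, hp2, hq2]
  ring

/-- Binomial expansion of `zonalAverage_eq` in powers of `⟨x, y⟩`. -/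
theorem exists_zonalAverage_eq_of_ne {n : ℕ} {a b : Fin n} (hab : a ≠ b) (k : ℕ) :
    ∃ d : ℕ → ℝ, ∀ x y : EuclideanSpace ℝ (Fin n), ‖x‖ = 1 → ‖y‖ = 1 →
      zonalAverage k x y = leadingMoment a b k * inner ℝ x y ^ k
        + ∑ j ∈ Finset.range k, d j * inner ℝ x y ^ j := by
  let M (ε : Fin n → ℤˣ) (U : On n) : ℝ :=
    ∑ i, ((ε i : ℤ) : ℝ) * ((U.1 a i ^ 2 + U.1 b i ^ 2) / 2)
  let N (ε : Fin n → ℤˣ) (U : On n) : ℝ :=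
    ∑ i, ((ε i : ℤ) : ℝ) * ((U.1 a i ^ 2 - U.1 b i ^ 2) / 2)
  have hM (ε : Fin n → ℤˣ) : Continuous (M ε) := continuous_sum_signs (fun i =>
    (((continuous_entry a i).pow 2).add ((continuous_entry b i).pow 2)).div_const 2) ε
  have hN (ε : Fin n → ℤˣ) : Continuous (N ε) := continuous_sum_signs (fun i =>
    (((continuous_entry a i).pow 2).sub ((continuous_entry b i).pow 2)).div_const 2) ε
  let D (j : ℕ) (U : On n) : ℝ :=
    (∑ ε : Fin n → ℤˣ, M ε U ^ j * N ε U ^ (k - j) * (k.choose j : ℝ)) / 2 ^ n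
  have hD (j : ℕ) : Continuous (D j) := (continuous_finsetSum _ fun ε _ =>
    (((hM ε).pow j).mul ((hN ε).pow (k - j))).mul continuous_const).div_const _
  refine ⟨fun j => ∫ U, D j U ∂haarOn n, fun x y hx hy => ?_⟩
  have hexp (U : On n) : (∑ ε : Fin n → ℤˣ, (inner ℝ x y * M ε U + N ε U) ^ k) / 2 ^ n
      = ∑ j ∈ Finset.range (k + 1), D j U * inner ℝ x y ^ j := by
    simp only [add_pow, D, Finset.sum_div, Finset.sum_mul]
    rw [Finset.sum_comm]
    refine Finset.sum_congr rfl fun j _ => Finset.sum_congr rfl fun ε _ => ?_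
    ring
  have hlead : ∫ U, D k U ∂haarOn n = leadingMoment a b k := by
    simp [D, M, leadingMoment]
  rw [zonalAverage_eq hab k hx hy]
  refine (integral_congr_ae (.of_forall hexp)).trans ?_
  rw [integral_finsetSum _ fun j _ => (integrable_haarOn (hD j)).mul_const _]
  simp only [integral_mul_const]
  rw [Finset.sum_range_succ, hlead, add_comm]

theorem exists_zonalAverage_eq {n : ℕ} (hn : 1 ≤ n) {k : ℕ} (hk : 1 ≤ k) :
    ∃ l : ℝ, l ≤ 2 / (n + 2) ∧ ∃ d : ℕ → ℝ, ∀ x y : EuclideanSpace ℝ (Fin n),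
      ‖x‖ = 1 → ‖y‖ = 1 → zonalAverage k x y = l * inner ℝ x y ^ k
        + ∑ j ∈ Finset.range k, d j * inner ℝ x y ^ j := by
  obtain rfl | hn2 : n = 1 ∨ 2 ≤ n := by omega
  · -- In dimension one every product `⟨x, v⟩⟨y, v⟩` is `±1`, so that the average is constant:
    -- `1` for even `k` and `0` for odd `k`.
    refine ⟨0, by norm_num, fun j => if j = 0 ∧ Even k then 1 else 0, fun x y hx hy => ?_⟩
    have hx2 : x 0 ^ 2 = 1 := by
      have h := EuclideanSpace.real_norm_sq_eq x
      rw [hx] at h; simpa using h.symm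
    have hy2 : y 0 ^ 2 = 1 := by
      have h := EuclideanSpace.real_norm_sq_eq y
      rw [hy] at h; simpa using h.symm
    have hterm (U : On 1) (ε : Fin 1 → ℤˣ) : (∑ i, ((ε i : ℤ) : ℝ) *
        (inner ℝ x (column U i) * inner ℝ y (column U i))) = ∑ i, ((ε i : ℤ) : ℝ) * (x 0 * y 0) := by
      have hU : U.1 0 0 ^ 2 = 1 := by simpa using sum_entry_sq_row U 0
      have e (z : EuclideanSpace ℝ (Fin 1)) : inner ℝ z (column U 0) = U.1 0 0 * z 0 := by
        simp [column, PiLp.inner_apply]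
      simp only [Finset.univ_unique, Fin.default_eq_zero, Finset.sum_singleton, e]
      linear_combination ((ε 0 : ℤ) : ℝ) * x 0 * y 0 * hU
    have hone (ε : Fin 1 → ℤˣ) : (∑ i, ((ε i : ℤ) : ℝ) * (x 0 * y 0)) ^ 2 = 1 := by
      rcases Int.units_eq_one_or (ε 0) with h | h <;> simp [h, mul_pow, hx2, hy2]
    have hsum : ∑ j ∈ Finset.range k, (if j = 0 ∧ Even k then (1 : ℝ) else 0) * inner ℝ x y ^ j
        = if Even k then 1 else 0 := by
      rw [Finset.sum_eq_single 0 (fun j _ hj => by simp [hj])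
        (fun h => absurd (Finset.mem_range.2 hk) h)]
      simp
    simp only [zonalAverage, hterm, hsum, zero_mul, zero_add]
    rcases Nat.even_or_odd k with hev | hodd
    · obtain ⟨m, rfl⟩ := hev
      simp only [← two_mul, pow_mul, hone, one_pow]
      simp
    · obtain ⟨m, rfl⟩ := hodd
      simp only [pow_succ, pow_mul, hone, one_pow, one_mul, pow_zero]
      rw [sum_signs_sum_mul]
      simp
  · have hab : (⟨0, by omega⟩ : Fin n) ≠ ⟨1, by omega⟩ := by simp
    exact ⟨_, leadingMoment_le hab hk, exists_zonalAverage_eq_of_ne hab k⟩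

/-! ### The averaged quadratic form on polynomials -/

/-- The function `x ↦ ⟨x, b⟩ ^ k` on the sphere. -/
noncomputable def zonalPower {n : ℕ} (k : ℕ) (b : Sph n) : C(Sph n, ℝ) where
  toFun x := inner ℝ x.1 b.1 ^ k
  continuous_toFun := (continuous_subtype_val.inner (𝕜 := ℝ) continuous_const).pow k

/-- The polynomial functions of degree at most `k` on the sphere, described as the span of the
powers `⟨·, b⟩ ^ j` with `j ≤ k`. -/
noncomputable def polySpace (n k : ℕ) : Submodule ℝ C(Sph n, ℝ) :=
  Submodule.span ℝ {g | ∃ j ≤ k, ∃ b : Sph n, g = zonalPower j b}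

theorem zonalPower_mem {n j k : ℕ} (hjk : j ≤ k) (b : Sph n) : zonalPower j b ∈ polySpace n k :=
  Submodule.subset_span ⟨j, hjk, b, rfl⟩

theorem polySpace_mono {n j k : ℕ} (hjk : j ≤ k) : polySpace n j ≤ polySpace n k :=
  Submodule.span_mono fun _ ⟨i, hi, b, hb⟩ => ⟨i, hi.trans hjk, b, hb⟩

instance finiteDimensional_polySpace (n k : ℕ) : FiniteDimensional ℝ (polySpace n k) := by
  let coord (i : Fin n) : C(Sph n, ℝ) := ⟨fun x => x.1 i, by fun_prop⟩
  let X : Submodule ℝ C(Sph n, ℝ) := Submodule.span ℝ (insert 1 (Set.range coord))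
  have hX : X.FG := Submodule.fg_span ((Set.finite_range coord).insert 1)
  have h1 : 1 ∈ X := Submodule.subset_span (Set.mem_insert _ _)
  have hb (b : Sph n) : zonalPower 1 b ∈ X := by
    have h : zonalPower 1 b = ∑ i, b.1 i • coord i := by
      ext x
      simp [zonalPower, coord, PiLp.inner_apply]
    rw [h]
    exact Submodule.sum_mem _ fun i _ => Submodule.smul_mem _ _
      (Submodule.subset_span (Set.mem_insert_of_mem _ ⟨i, rfl⟩))
  have hle : polySpace n k ≤ X ^ k := by
    refine Submodule.span_le.2 ?_
    rintro _ ⟨j, hj, b, rfl⟩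
    have h : zonalPower j b = zonalPower 1 b ^ j * 1 ^ (k - j) := by
      ext x
      simp [zonalPower]
    rw [h, ← Nat.add_sub_of_le hj, pow_add, Nat.add_sub_cancel_left]
    exact Submodule.mul_mem_mul (Submodule.pow_mem_pow _ (hb b) _) (Submodule.pow_mem_pow _ h1 _)
  have : FiniteDimensional ℝ ↥(X ^ k) := Module.Finite.iff_fg.2 (hX.pow k)
  exact Submodule.finiteDimensional_of_le hle

/-- The averaged bilinear form `𝔼_U ⟨f', g⟩`, where `f'` is the symmetrization of `f` with respect
to the columns of `U`. -/
noncomputable def symmForm {n : ℕ} (f g : C(Sph n, ℝ)) : ℝ :=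
  ∫ U : On n, ∫ x, orthoSymm (columnBasis U) f x * g x ∂sphereProb n ∂haarOn n

theorem memLp_continuousMap {n : ℕ} [IsProbabilityMeasure (sphereProb n)] (f : C(Sph n, ℝ)) :
    MemLp f 2 (sphereProb n) :=
  MemLp.of_bound f.continuous.aestronglyMeasurable ‖f‖ (.of_forall f.norm_coe_le_norm)

theorem integrable_continuousMap {n : ℕ} [IsProbabilityMeasure (sphereProb n)]
    (f : C(Sph n, ℝ)) : Integrable f (sphereProb n) :=
  f.continuous.integrable_of_hasCompactSupport (HasCompactSupport.of_compactSpace _)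

instance firstCountableTopology_On (n : ℕ) : FirstCountableTopology (On n) := by
  have : FirstCountableTopology (Matrix (Fin n) (Fin n) ℝ) :=
    inferInstanceAs (FirstCountableTopology (Fin n → Fin n → ℝ))
  exact Topology.IsInducing.subtypeVal.firstCountableTopology

theorem continuous_integral_orthoSymm_mul {n : ℕ} [IsProbabilityMeasure (sphereProb n)]
    (f g : C(Sph n, ℝ)) :
    Continuous fun U : On n => ∫ x, orthoSymm (columnBasis U) f x * g x ∂sphereProb n := by
  have h : Continuous (Function.uncurry fun (U : On n) (x : Sph n) =>
      orthoSymm (columnBasis U) f x * g x) :=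
    (continuous_uncurry_orthoSymm f.continuous).mul (g.continuous.comp continuous_snd)
  simpa using continuous_parametric_integral_of_continuous h isCompact_univ (μ := sphereProb n)

theorem symmForm_comm {n : ℕ} [IsProbabilityMeasure (sphereProb n)] (f g : C(Sph n, ℝ)) :
    symmForm f g = symmForm g f := by
  refine integral_congr_ae (.of_forall fun U => ?_)
  simp only
  rw [integral_orthoSymm_mul _ (memLp_continuousMap f) (memLp_continuousMap g)]
  simp only [mul_comm]

theorem symmForm_add_left {n : ℕ} [IsProbabilityMeasure (sphereProb n)] (f g h : C(Sph n, ℝ)) :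
    symmForm (f + g) h = symmForm f h + symmForm g h := by
  rw [symmForm, symmForm, symmForm, ← integral_add
    (integrable_haarOn (continuous_integral_orthoSymm_mul f h))
    (integrable_haarOn (continuous_integral_orthoSymm_mul g h))]
  refine integral_congr_ae (.of_forall fun U => ?_)
  simp only
  have hi (f : C(Sph n, ℝ)) :
      Integrable (fun x => orthoSymm (columnBasis U) f x * h x) (sphereProb n) :=
    (memLp_orthoSymm _ (memLp_continuousMap f)).integrable_mul (memLp_continuousMap h)
  rw [← integral_add (hi f) (hi g)]
  refine integral_congr_ae (.of_forall fun x => ?_)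
  simp [orthoSymm_add, add_mul]

theorem symmForm_smul_left {n : ℕ} (c : ℝ) (f h : C(Sph n, ℝ)) :
    symmForm (c • f) h = c * symmForm f h := by
  simp only [symmForm, ← integral_const_mul]
  refine integral_congr_ae (.of_forall fun U => integral_congr_ae (.of_forall fun x => ?_))
  simp [orthoSymm_smul, mul_assoc]

theorem symmForm_zonalPower {n : ℕ} [IsProbabilityMeasure (sphereProb n)] (k : ℕ) (b : Sph n)
    (g : C(Sph n, ℝ)) :
    symmForm (zonalPower k b) g = ∫ x, zonalAverage k x.1 b.1 * g x ∂sphereProb n := by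
  have h : Continuous (Function.uncurry fun (U : On n) (x : Sph n) =>
      orthoSymm (columnBasis U) (zonalPower k b) x * g x) :=
    (continuous_uncurry_orthoSymm (zonalPower k b).continuous).mul
      (g.continuous.comp continuous_snd)
  rw [symmForm, integral_integral_swap_of_hasCompactSupport h
    (HasCompactSupport.of_compactSpace _)]
  refine integral_congr_ae (.of_forall fun x => ?_)
  simp only [integral_mul_const]
  congr 1
  refine integral_congr_ae (.of_forall fun U => ?_)
  simp [orthoSymm, zonalPower, sphereFlip, inner_signFlip, columnBasis_apply]

/-- Pointwise form of the triangularity, on a single power of a linear form. -/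
theorem exists_zonalAverage_mem {n : ℕ} (hn : 1 ≤ n) (k : ℕ) :
    ∃ l : ℝ, l ≤ 2 / (n + 2) ∧ ∀ b : Sph n, ∃ r ∈ polySpace n k, ∀ x : Sph n,
      zonalAverage (k + 1) x.1 b.1 = (l • zonalPower (k + 1) b + r) x := by
  obtain ⟨l, hl, d, hd⟩ := exists_zonalAverage_eq hn (Nat.succ_pos k)
  refine ⟨l, hl, fun b => ⟨∑ j ∈ Finset.range (k + 1), d j • zonalPower j b,
    Submodule.sum_mem _ fun j hj => Submodule.smul_mem _ _
      (zonalPower_mem (Nat.lt_succ_iff.1 (Finset.mem_range.1 hj)) b), fun x => ?_⟩⟩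
  rw [hd x.1 b.1 (mem_sphere_zero_iff_norm.1 x.2) (mem_sphere_zero_iff_norm.1 b.2)]
  simp [zonalPower]

theorem exists_symmForm_zonalPower {n : ℕ} (hn : 1 ≤ n) (k : ℕ) (b : Sph n) :
    ∃ r ∈ polySpace n k, ∀ g, symmForm (zonalPower k b) g = ∫ x, r x * g x ∂sphereProb n := by
  have := isProbabilityMeasure_sphereProb hn
  rcases k with _ | k
  · refine ⟨zonalPower 0 b, zonalPower_mem le_rfl b, fun g => ?_⟩
    rw [symmForm_zonalPower]
    simp [zonalAverage, zonalPower]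
  · obtain ⟨l, -, h⟩ := exists_zonalAverage_mem hn k
    obtain ⟨r, hr, h⟩ := h b
    refine ⟨l • zonalPower (k + 1) b + r, Submodule.add_mem _ (Submodule.smul_mem _ _
      (zonalPower_mem le_rfl b)) (polySpace_mono k.le_succ hr), fun g => ?_⟩
    rw [symmForm_zonalPower]
    simp only [h]

/-- The averaged symmetrization is triangular for the filtration by degree, with a scalar at most
`2 / (n + 2)` on each graded piece of positive degree. -/
theorem exists_symmForm_eq {n : ℕ} (hn : 1 ≤ n) (k : ℕ) :
    ∃ l : ℝ, l ≤ 2 / (n + 2) ∧ ∀ f ∈ polySpace n (k + 1), ∃ r ∈ polySpace n k, ∀ g,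
      symmForm f g = ∫ x, (l • f + r) x * g x ∂sphereProb n := by
  have := isProbabilityMeasure_sphereProb hn
  obtain ⟨l, hl, h⟩ := exists_zonalAverage_mem hn k
  refine ⟨l, hl, fun f hf => ?_⟩
  have hi (f g : C(Sph n, ℝ)) : Integrable (fun x => f x * g x) (sphereProb n) :=
    integrable_continuousMap (f * g)
  induction hf using Submodule.span_induction with
  | mem f hf =>
    obtain ⟨j, hj, b, rfl⟩ := hf
    obtain rfl | hjk : j = k + 1 ∨ j ≤ k := by omega
    · obtain ⟨r, hr, h⟩ := h b
      refine ⟨r, hr, fun g => ?_⟩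
      rw [symmForm_zonalPower]
      simp only [h]
    · obtain ⟨r, hr, h⟩ := exists_symmForm_zonalPower hn j b
      refine ⟨r - l • zonalPower j b, Submodule.sub_mem _ (polySpace_mono hjk hr)
        (Submodule.smul_mem _ _ (zonalPower_mem hjk b)), fun g => ?_⟩
      rw [h, add_sub_cancel]
  | zero =>
    refine ⟨0, Submodule.zero_mem _, fun g => ?_⟩
    simpa using symmForm_smul_left 0 (0 : C(Sph n, ℝ)) g
  | add f₁ f₂ _ _ h₁ h₂ =>
    obtain ⟨r₁, hr₁, h₁⟩ := h₁
    obtain ⟨r₂, hr₂, h₂⟩ := h₂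
    refine ⟨r₁ + r₂, Submodule.add_mem _ hr₁ hr₂, fun g => ?_⟩
    rw [symmForm_add_left, h₁, h₂, ← integral_add (hi _ _) (hi _ _)]
    refine integral_congr_ae (.of_forall fun x => ?_)
    simp only [ContinuousMap.add_apply, ContinuousMap.smul_apply, smul_eq_mul]
    ring
  | smul c f _ h =>
    obtain ⟨r, hr, h⟩ := h
    refine ⟨c • r, Submodule.smul_mem _ _ hr, fun g => ?_⟩
    rw [symmForm_smul_left, h, ← integral_const_mul]
    refine integral_congr_ae (.of_forall fun x => ?_)
    simp only [ContinuousMap.add_apply, ContinuousMap.smul_apply, smul_eq_mul]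
    ring

theorem exists_orthogonal_decomposition {n : ℕ} [IsProbabilityMeasure (sphereProb n)] (k : ℕ)
    (f : C(Sph n, ℝ)) : ∃ g ∈ polySpace n k, ∀ h ∈ polySpace n k,
      ∫ x, (f - g) x * h x ∂sphereProb n = 0 := by
  let ι := (ContinuousMap.toLp 2 (sphereProb n) ℝ : C(Sph n, ℝ) →L[ℝ] _).toLinearMap
  let W := (polySpace n k).map ι
  have : FiniteDimensional ℝ W := inferInstance
  obtain ⟨g, hg, hgW⟩ : (W.starProjection (ι f)) ∈ W := W.starProjection_apply_mem _
  refine ⟨g, hg, fun h hh => ?_⟩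
  have h0 := W.starProjection_inner_eq_zero (ι f) (ι h) ⟨h, hh, rfl⟩
  rw [← hgW, ← map_sub] at h0
  have h1 := ContinuousMap.inner_toLp (𝕜 := ℝ) (sphereProb n) (f - g) h
  rw [← h1.symm.trans h0]
  refine integral_congr_ae (.of_forall fun x => ?_)
  simp [mul_comm]

/-- Symmetry and triangularity diagonalize the form along the filtration: a polynomial `h` of
degree `k + 1` that is orthogonal to those of degree `k` is also orthogonal to them for
`symmForm`, and `symmForm h h` is the scalar of degree `k + 1` times `‖h‖²`. Mean zero removes
the constants, on which the scalar is `1`. -/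
theorem symmForm_self_le {n : ℕ} (hn : 1 ≤ n) (k : ℕ) {f : C(Sph n, ℝ)} (hf : f ∈ polySpace n k)
    (hmean : ∫ x, f x ∂sphereProb n = 0) :
    symmForm f f ≤ 2 / (n + 2) * ∫ x, f x * f x ∂sphereProb n := by
  have := isProbabilityMeasure_sphereProb hn
  have hi (f g : C(Sph n, ℝ)) : Integrable (fun x => f x * g x) (sphereProb n) :=
    integrable_continuousMap (f * g)
  induction k generalizing f with
  | zero =>
    have hle : polySpace n 0 ≤ Submodule.span ℝ {1} := by
      refine Submodule.span_le.2 ?_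
      rintro _ ⟨j, hj, b, rfl⟩
      obtain rfl : j = 0 := by omega
      have h : zonalPower 0 b = 1 := by ext x; simp [zonalPower]
      rw [h]
      exact Submodule.mem_span_singleton_self _
    obtain ⟨c, rfl⟩ := Submodule.mem_span_singleton.1 (hle hf)
    obtain rfl : c = 0 := by simpa using hmean
    rw [symmForm_smul_left]
    simp
  | succ k ih =>
    obtain ⟨g, hg, hgf⟩ := exists_orthogonal_decomposition k f
    set h := f - g with hh
    have hfgh : f = g + h := by rw [hh]; abel
    have hhV : h ∈ polySpace n (k + 1) := Submodule.sub_mem _ hf (polySpace_mono k.le_succ hg)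
    obtain ⟨l, hl, H⟩ := exists_symmForm_eq hn k
    have : Nonempty (Sph n) := by
      by_contra hne
      rw [not_nonempty_iff] at hne
      exact IsProbabilityMeasure.ne_zero (sphereProb n) (Measure.eq_zero_of_isEmpty _)
    obtain ⟨b⟩ := this
    have hh0 : ∫ x, h x ∂sphereProb n = 0 := by
      simpa [zonalPower] using hgf _ (zonalPower_mem (Nat.zero_le k) b)
    have hg0 : ∫ x, g x ∂sphereProb n = 0 := by
      rw [hfgh] at hmean
      have := integral_add (integrable_continuousMap g) (integrable_continuousMap h)
      simp only [ContinuousMap.add_apply] at hmean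
      linarith
    have key (g' : C(Sph n, ℝ)) (hg' : g' ∈ polySpace n k) : symmForm h g' = 0 := by
      obtain ⟨r, hr, hB⟩ := H g' (polySpace_mono k.le_succ hg')
      rw [symmForm_comm, hB]
      simpa [mul_comm] using
        hgf (l • g' + r) (Submodule.add_mem _ (Submodule.smul_mem _ _ hg') hr)
    have hhh : symmForm h h = l * ∫ x, h x * h x ∂sphereProb n := by
      obtain ⟨r, hr, hB⟩ := H h hhV
      have e := hgf r hr
      rw [hB, ← integral_const_mul]
      have : ∫ x, (l • h + r) x * h x ∂sphereProb n
          = ∫ x, l * (h x * h x) + h x * r x ∂sphereProb n := by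
        refine integral_congr_ae (.of_forall fun x => ?_)
        simp only [ContinuousMap.add_apply, ContinuousMap.smul_apply, smul_eq_mul]
        ring
      rw [this, integral_add ((hi h h).const_mul l) (hi h r), e, add_zero]
    have hform : symmForm f f = symmForm g g + symmForm h h := by
      rw [hfgh, symmForm_add_left, symmForm_comm g, symmForm_comm h, symmForm_add_left,
        symmForm_add_left, key g hg, symmForm_comm g h, key g hg]
      ring
    have hnorm : ∫ x, f x * f x ∂sphereProb n
        = ∫ x, g x * g x ∂sphereProb n + ∫ x, h x * h x ∂sphereProb n := by
      have e := hgf g hg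
      have : ∫ x, f x * f x ∂sphereProb n
          = ∫ x, g x * g x + h x * h x + 2 * (h x * g x) ∂sphereProb n := by
        refine integral_congr_ae (.of_forall fun x => ?_)
        simp only [hfgh, ContinuousMap.add_apply]
        ring
      have hi2 : Integrable (fun x => g x * g x + h x * h x) (sphereProb n) :=
        (hi g g).add (hi h h)
      rw [this, integral_add hi2 ((hi h g).const_mul 2), integral_add (hi g g) (hi h h),
        integral_const_mul, e]
      ring
    rw [hform, hnorm, mul_add, hhh]
    exact add_le_add (ih hg hg0)
      (mul_le_mul_of_nonneg_right hl (integral_nonneg fun x => mul_self_nonneg _))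

/-! ### Density of polynomials -/

/-- The linear form `x ↦ ⟨x, c⟩` on the sphere. -/
noncomputable def linearForm {n : ℕ} (c : EuclideanSpace ℝ (Fin n)) : C(Sph n, ℝ) where
  toFun x := inner ℝ x.1 c
  continuous_toFun := continuous_subtype_val.inner (𝕜 := ℝ) continuous_const

/-- The exponential `x ↦ exp ⟨x, c⟩` on the sphere. -/
noncomputable def expForm {n : ℕ} (c : EuclideanSpace ℝ (Fin n)) : C(Sph n, ℝ) where
  toFun x := Real.exp (inner ℝ x.1 c)
  continuous_toFun := Real.continuous_exp.comp (linearForm c).continuous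

theorem hasSum_expForm {n : ℕ} (c : EuclideanSpace ℝ (Fin n)) :
    HasSum (fun k : ℕ => ((k.factorial : ℝ)⁻¹) • linearForm c ^ k) (expForm c) := by
  have h := NormedSpace.exp_series_hasSum_exp' (𝕂 := ℝ) (linearForm c)
  convert! h
  ext x
  have h1 := h.mapL (ContinuousMap.evalCLM ℝ x)
  have h2 := NormedSpace.exp_series_hasSum_exp' (𝕂 := ℝ) (inner ℝ x.1 c)
  rw [← Real.exp_eq_exp_ℝ] at h2
  exact h2.unique h1

theorem linearForm_pow_mem {n : ℕ} (hn : 1 ≤ n) (c : EuclideanSpace ℝ (Fin n)) (k : ℕ) :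
    linearForm c ^ k ∈ ⨆ k, polySpace n k := by
  obtain ⟨B, hB⟩ := exists_orthonormalBasis_eq_norm_smul ⟨0, hn⟩ c
  have h : linearForm c ^ k = ‖c‖ ^ k • zonalPower k ⟨B ⟨0, hn⟩, by simp⟩ := by
    ext x
    have : inner ℝ x.1 c = ‖c‖ * inner ℝ x.1 (B ⟨0, hn⟩) := by
      conv_lhs => rw [hB, inner_smul_right]
    simp [linearForm, zonalPower, this, mul_pow]
  rw [h]
  exact Submodule.smul_mem _ _ (Submodule.mem_iSup_of_mem k (zonalPower_mem le_rfl _))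

/-- Polynomials are dense in the continuous functions on the sphere. The exponentials
`exp ⟨·, c⟩` are limits of polynomials and span a point-separating subalgebra, so that no
polarization identity for products of powers is needed. -/
theorem topologicalClosure_iSup_polySpace {n : ℕ} (hn : 1 ≤ n) :
    (⨆ k, polySpace n k).topologicalClosure = ⊤ := by
  let S : Submonoid C(Sph n, ℝ) :=
    { carrier := Set.range expForm
      one_mem' := ⟨0, by ext x; simp [expForm]⟩
      mul_mem' := by
        rintro _ _ ⟨c, rfl⟩ ⟨d, rfl⟩
        exact ⟨c + d, by ext x; simp [expForm, inner_add_right, Real.exp_add]⟩ }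
  have hA : (Algebra.adjoin ℝ (S : Set C(Sph n, ℝ))).topologicalClosure = ⊤ := by
    refine ContinuousMap.subalgebra_topologicalClosure_eq_top_of_separatesPoints _ ?_
    intro x y hxy
    refine ⟨_, ⟨expForm (x.1 - y.1), Algebra.subset_adjoin ⟨_, rfl⟩, rfl⟩, fun h => hxy ?_⟩
    have h1 : inner ℝ x.1 (x.1 - y.1) = inner ℝ y.1 (x.1 - y.1) := Real.exp_injective h
    rw [← sub_eq_zero, ← inner_sub_left, inner_self_eq_zero, sub_eq_zero] at h1
    exact Subtype.ext h1
  have hle : Subalgebra.toSubmodule (Algebra.adjoin ℝ (S : Set C(Sph n, ℝ)))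
      ≤ (⨆ k, polySpace n k).topologicalClosure := by
    rw [Algebra.adjoin_eq_span, Submonoid.closure_eq]
    refine Submodule.span_le.2 ?_
    rintro _ ⟨c, rfl⟩
    refine (Submodule.isClosed_topologicalClosure _).mem_of_tendsto (hasSum_expForm c)
      (.of_forall fun s => Submodule.sum_mem _ fun k _ => Submodule.smul_mem _ _
        (Submodule.le_topologicalClosure _ (linearForm_pow_mem hn c k)))
  rw [eq_top_iff]
  intro f _
  have hf : f ∈ (Algebra.adjoin ℝ (S : Set C(Sph n, ℝ))).topologicalClosure := hA ▸ trivial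
  exact closure_minimal hle (Submodule.isClosed_topologicalClosure _) hf

theorem exists_polySpace_norm_sub_le {n : ℕ} (hn : 1 ≤ n) (g : C(Sph n, ℝ)) {δ : ℝ}
    (hδ : 0 < δ) : ∃ k, ∃ p ∈ polySpace n k, ‖g - p‖ ≤ δ := by
  have hg : g ∈ closure ((⨆ k, polySpace n k : Submodule ℝ C(Sph n, ℝ)) : Set C(Sph n, ℝ)) := by
    rw [← Submodule.topologicalClosure_coe, topologicalClosure_iSup_polySpace hn]; trivial
  obtain ⟨p, hp, hd⟩ := Metric.mem_closure_iff.1 hg δ hδ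
  obtain ⟨k, hk⟩ := (Submodule.mem_iSup_of_directed _
    (directed_of_isDirected_le fun _ _ h => polySpace_mono h)).1 hp
  exact ⟨k, p, hk, by rw [← dist_eq_norm]; exact hd.le⟩

/-! ### Approximation in `L₂` and the averaged norm -/

theorem integral_sub_integral_mul_self {α : Type*} [MeasurableSpace α] {μ : Measure α}
    [IsProbabilityMeasure μ] {h : α → ℝ} (hi : Integrable h μ)
    (hi2 : Integrable (fun x => h x * h x) μ) :
    ∫ x, (h x - ∫ y, h y ∂μ) * (h x - ∫ y, h y ∂μ) ∂μ
      = ∫ x, h x * h x ∂μ - (∫ x, h x ∂μ) ^ 2 := by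
  set c := ∫ x, h x ∂μ with hc
  have h1 : ∫ x, (h x - c) * (h x - c) ∂μ = ∫ x, (h x * h x - 2 * c * h x) + c ^ 2 ∂μ :=
    integral_congr_ae (.of_forall fun x => by simp only; ring)
  have i1 : Integrable (fun x => h x * h x - 2 * c * h x) μ := hi2.sub (hi.const_mul _)
  rw [h1, integral_add i1 (integrable_const _), integral_sub hi2 (hi.const_mul _),
    integral_const_mul, ← hc]
  simp; ring

theorem sq_integral_le {α : Type*} [MeasurableSpace α] {μ : Measure α} [IsProbabilityMeasure μ]
    {h : α → ℝ} (hi : Integrable h μ) (hi2 : Integrable (fun x => h x * h x) μ) :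
    (∫ x, h x ∂μ) ^ 2 ≤ ∫ x, h x * h x ∂μ := by
  rw [← sub_nonneg, ← integral_sub_integral_mul_self hi hi2]
  exact integral_nonneg fun x => mul_self_nonneg _

theorem l2Norm_le_of_norm_le {n : ℕ} [IsProbabilityMeasure (sphereProb n)] (g : C(Sph n, ℝ))
    {δ : ℝ} (hg : ‖g‖ ≤ δ) : l2Norm g ≤ δ := by
  have hδ : 0 ≤ δ := (norm_nonneg g).trans hg
  have h := eLpNorm_le_of_ae_bound (p := 2) (μ := sphereProb n) (f := g) (C := δ)
    (.of_forall fun x => (g.norm_coe_le_norm x).trans hg)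
  simp only [measure_univ, ENNReal.one_rpow, one_mul] at h
  exact ENNReal.toReal_le_of_le_ofReal hδ h

theorem exists_continuousMap_l2Norm_sub_le {n : ℕ} [IsProbabilityMeasure (sphereProb n)]
    {f : Sph n → ℝ} (hf : MemLp f 2 (sphereProb n)) {δ : ℝ} (hδ : 0 < δ) :
    ∃ g : C(Sph n, ℝ), l2Norm (f - ⇑g) ≤ δ := by
  obtain ⟨g, hg, -⟩ := hf.exists_boundedContinuous_eLpNorm_sub_le (by norm_num)
    (ENNReal.ofReal_pos.2 hδ).ne'
  exact ⟨g.toContinuousMap, ENNReal.toReal_le_of_le_ofReal hδ.le hg⟩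

/-- Subtracting the mean does not increase the `L₂` distance to a function of mean zero. -/
theorem exists_polySpace_l2Norm_sub_le {n : ℕ} (hn : 1 ≤ n) {f : Sph n → ℝ}
    (hf : MemLp f 2 (sphereProb n)) (hmean : ∫ x, f x ∂sphereProb n = 0) {δ : ℝ} (hδ : 0 < δ) :
    ∃ k, ∃ p ∈ polySpace n k, ∫ x, p x ∂sphereProb n = 0 ∧ l2Norm (f - ⇑p) ≤ δ := by
  have := isProbabilityMeasure_sphereProb hn
  obtain ⟨g, hg⟩ := exists_continuousMap_l2Norm_sub_le hf (half_pos hδ)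
  obtain ⟨k, p, hp, hgp⟩ := exists_polySpace_norm_sub_le hn g (half_pos hδ)
  have hL := @memLp_continuousMap n _
  have hfp : l2Norm (f - ⇑p) ≤ δ := by
    have h := l2Norm_add_le (hf.sub (hL g)) ((hL g).sub (hL p))
    rw [sub_add_sub_cancel] at h
    have h2 : l2Norm (⇑g - ⇑p) ≤ δ / 2 := l2Norm_le_of_norm_le (g - p) hgp
    linarith
  set h := f - ⇑p with hh
  have hLh : MemLp h 2 (sphereProb n) := hf.sub (hL p)
  have hfi : Integrable f (sphereProb n) := hf.integrable (by norm_num)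
  set c := ∫ x, p x ∂sphereProb n with hc
  have hhc : ∫ x, h x ∂sphereProb n = -c := by
    simp only [hh, Pi.sub_apply]
    rw [integral_sub hfi (integrable_continuousMap p), hmean, zero_sub]
  have h1 : (1 : C(Sph n, ℝ)) ∈ polySpace n k := by
    have h1 : (1 : C(Sph n, ℝ)) ∈ polySpace n 0 := by
      obtain ⟨B, -⟩ := exists_orthonormalBasis_eq_norm_smul ⟨0, hn⟩ (0 : EuclideanSpace ℝ (Fin n))
      have : (1 : C(Sph n, ℝ)) = zonalPower 0 ⟨B ⟨0, hn⟩, by simp⟩ := by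
        ext x; simp [zonalPower]
      rw [this]; exact zonalPower_mem le_rfl _
    exact polySpace_mono k.zero_le h1
  refine ⟨k, p - c • 1, Submodule.sub_mem _ hp (Submodule.smul_mem _ _ h1), ?_, ?_⟩
  · simp only [ContinuousMap.sub_apply, ContinuousMap.smul_apply, ContinuousMap.one_apply,
      smul_eq_mul, mul_one]
    rw [integral_sub (integrable_continuousMap p) (integrable_const _)]
    simp [hc]
  · refine le_trans ?_ hfp
    have hL2 : MemLp (f - ⇑(p - c • (1 : C(Sph n, ℝ)))) 2 (sphereProb n) := hf.sub (hL _)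
    rw [← abs_of_nonneg (l2Norm_nonneg (f - ⇑(p - c • (1 : C(Sph n, ℝ))))),
      ← abs_of_nonneg (l2Norm_nonneg h), ← sq_le_sq, l2Norm_sq hL2, l2Norm_sq hLh]
    have hvar := integral_sub_integral_mul_self (hLh.integrable (by norm_num))
      (hLh.integrable_mul hLh)
    refine le_trans (le_of_eq ?_) (hvar.le.trans (sub_le_self _ (sq_nonneg _)))
    refine integral_congr_ae (.of_forall fun x => ?_)
    simp only [hhc]
    simp only [hh, Pi.sub_apply, ContinuousMap.sub_apply, ContinuousMap.smul_apply,
      ContinuousMap.one_apply, smul_eq_mul]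
    ring

/-- For continuous `f` this is continuity of a parametric integral; a general `f` gives a uniform
limit of such functions of `U`, since every symmetrization is a contraction of `L₂`. -/
theorem continuous_l2Norm_orthoSymm {n : ℕ} [IsProbabilityMeasure (sphereProb n)]
    {f : Sph n → ℝ} (hf : MemLp f 2 (sphereProb n)) :
    Continuous fun U : On n => l2Norm (orthoSymm (columnBasis U) f) := by
  have hcont (g : C(Sph n, ℝ)) :
      Continuous fun U : On n => l2Norm (orthoSymm (columnBasis U) g) := by
    have h (U : On n) : l2Norm (orthoSymm (columnBasis U) g)
        = √(∫ x, orthoSymm (columnBasis U) g x * g x ∂sphereProb n) := by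
      rw [← l2Norm_orthoSymm_sq _ (memLp_continuousMap g), Real.sqrt_sq (l2Norm_nonneg _)]
    simp only [h]
    exact (continuous_integral_orthoSymm_mul g g).sqrt
  refine continuous_of_uniform_approx_of_continuous fun u hu => ?_
  obtain ⟨δ, hδ, hu⟩ := Metric.mem_uniformity_dist.1 hu
  obtain ⟨g, hg⟩ := exists_continuousMap_l2Norm_sub_le hf (half_pos hδ)
  refine ⟨_, hcont g, fun U => hu ?_⟩
  have h1 := l2Norm_orthoSymm_le_add_sub (columnBasis U) hf (memLp_continuousMap g)
  have h2 := l2Norm_orthoSymm_le_add_sub (columnBasis U) (memLp_continuousMap g) hf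
  rw [l2Norm_sub_comm] at h2
  rw [Real.dist_eq, abs_lt]
  constructor <;> linarith

theorem integral_l2Norm_orthoSymm_le_of_mem_polySpace {n : ℕ} (hn : 1 ≤ n) {k : ℕ}
    {p : C(Sph n, ℝ)} (hp : p ∈ polySpace n k) (hmean : ∫ x, p x ∂sphereProb n = 0) :
    ∫ U : On n, l2Norm (orthoSymm (columnBasis U) p) ∂haarOn n
      ≤ √(2 / (n + 2)) * l2Norm p := by
  have := isProbabilityMeasure_sphereProb hn
  have hL := memLp_continuousMap p
  have hc := continuous_l2Norm_orthoSymm hL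
  have h1 := sq_integral_le (integrable_haarOn hc) (integrable_haarOn (hc.mul hc))
  simp only [← sq, l2Norm_orthoSymm_sq _ hL] at h1
  have h2 := h1.trans (symmForm_self_le hn k hp hmean)
  rw [← l2Norm_sq hL] at h2
  refine le_of_sq_le_sq ?_ (mul_nonneg (Real.sqrt_nonneg _) (l2Norm_nonneg _))
  rw [mul_pow, Real.sq_sqrt (by positivity)]
  exact h2

theorem integral_l2Norm_orthoSymm_le {n : ℕ} (hn : 1 ≤ n) {f : Sph n → ℝ}
    (hf : MemLp f 2 (sphereProb n)) (hmean : ∫ x, f x ∂sphereProb n = 0) :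
    ∫ U : On n, l2Norm (orthoSymm (columnBasis U) f) ∂haarOn n
      ≤ √(2 / (n + 2)) * l2Norm f := by
  have := isProbabilityMeasure_sphereProb hn
  set s := √(2 / ((n : ℝ) + 2))
  have hs : 0 ≤ s := Real.sqrt_nonneg _
  refine le_of_forall_pos_le_add fun η hη => ?_
  have hδ : 0 < η / (s + 1) := by positivity
  obtain ⟨k, p, hp, hp0, hfp⟩ := exists_polySpace_l2Norm_sub_le hn hf hmean hδ
  have hL := memLp_continuousMap p
  have h1 : ∫ U : On n, l2Norm (orthoSymm (columnBasis U) f) ∂haarOn n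
      ≤ ∫ U : On n, l2Norm (orthoSymm (columnBasis U) p) + η / (s + 1) ∂haarOn n := by
    refine integral_mono (integrable_haarOn (continuous_l2Norm_orthoSymm hf))
      (integrable_haarOn ((continuous_l2Norm_orthoSymm hL).add continuous_const)) fun U => ?_
    have := l2Norm_orthoSymm_le_add_sub (columnBasis U) hf hL
    simp only
    linarith
  rw [integral_add (integrable_haarOn (continuous_l2Norm_orthoSymm hL)) (integrable_const _)] at h1
  simp only [integral_const, probReal_univ, one_smul] at h1
  have h2 := integral_l2Norm_orthoSymm_le_of_mem_polySpace hn hp hp0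
  have h3 := l2Norm_le_add_sub hL hf
  rw [l2Norm_sub_comm] at h3
  have h4 : s * l2Norm p ≤ s * (l2Norm f + η / (s + 1)) :=
    mul_le_mul_of_nonneg_left (h3.trans (by linarith)) hs
  have h5 : s * (η / (s + 1)) + η / (s + 1) = η := by field_simp
  linarith

end OrthogonalSymmetrization

theorem mainTheorem5 (n : ℕ) (hn : 1 ≤ n) (f : OrthogonalSymmetrization.Sph n → ℝ)
    (hf : MemLp f 2 (OrthogonalSymmetrization.sphereProb n))
    (hmean : ∫ x, f x ∂(OrthogonalSymmetrization.sphereProb n) = 0)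
    (hne : ¬ f =ᵐ[OrthogonalSymmetrization.sphereProb n] 0) :
    (∀ U : OrthogonalSymmetrization.On n,
      MemLp (OrthogonalSymmetrization.orthoSymm (OrthogonalSymmetrization.columnBasis U) f) 2
        (OrthogonalSymmetrization.sphereProb n)) ∧
    Integrable (fun U : OrthogonalSymmetrization.On n =>
        OrthogonalSymmetrization.l2Norm
          (OrthogonalSymmetrization.orthoSymm (OrthogonalSymmetrization.columnBasis U) f))
      (OrthogonalSymmetrization.haarOn n) ∧
    ∫ U : OrthogonalSymmetrization.On n,
        OrthogonalSymmetrization.l2Norm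
          (OrthogonalSymmetrization.orthoSymm (OrthogonalSymmetrization.columnBasis U) f)
        ∂(OrthogonalSymmetrization.haarOn n)
      < Real.sqrt 2 / Real.sqrt n * OrthogonalSymmetrization.l2Norm f := by
  have := OrthogonalSymmetrization.isProbabilityMeasure_sphereProb hn
  refine ⟨fun U => OrthogonalSymmetrization.memLp_orthoSymm _ hf,
    OrthogonalSymmetrization.integrable_haarOn
      (OrthogonalSymmetrization.continuous_l2Norm_orthoSymm hf), ?_⟩
  refine (OrthogonalSymmetrization.integral_l2Norm_orthoSymm_le hn hf hmean).trans_lt ?_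
  have hn0 : (0 : ℝ) < n := by exact_mod_cast hn
  have hpos : 0 < OrthogonalSymmetrization.l2Norm f :=
    ENNReal.toReal_pos
      (fun h => hne ((eLpNorm_eq_zero_iff hf.aestronglyMeasurable (by norm_num)).1 h))
      hf.eLpNorm_ne_top
  refine mul_lt_mul_of_pos_right ?_ hpos
  rw [← Real.sqrt_div (by norm_num)]
  exact Real.sqrt_lt_sqrt (by positivity) (div_lt_div_of_pos_left two_pos hn0 (by linarith))
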